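/- **Theorem (Bicomplex $(\vartheta,\varphi)$-Borel-Pompeiu formula).** Write each bicomplex number in the idempotent form $Z=z_1\mathbf e+z_2\mathbf e^\dagger$ with $z_1,z_2\in\mathbb C=\mathbb C(\mathbf i)$, $z_l=x_l+\mathbf i y_l$, $\mathbf e=\frac12(1+\mathbf{ij})$, $\mathbf e^\dagger=\frac12(1-\mathbf{ij})$. *Weights.* Let $\vartheta=\vartheta_1\mathbf e+\vartheta_2\mathbf e^\dagger$ and $\varphi=\varphi_1\mathbf e+\varphi_2\mathbf e^\dagger$ be bicomplex constants such that, for $l=1,2$, the complex numbers $\vartheta_l,\varphi_l$ are linearly independent over $\mathbb R$ (for instance non-zero and orthogonal, $\overline{\vartheta_l}\varphi_l+\overline{\varphi_l}\vartheta_l=0$). For complex $\psi=(\psi_0,\psi_1)$ linearly independent over $\mathbb R$ let $r_0=|\psi_0|$, $r_1=|\psi_1|$, let $\alpha\in(0,\pi)$ be the angle between $\psi_0$ and $\psi_1$, and put $$N_\psi(x,y)=\Big(\frac{x}{r_0^2}-\frac{y\cos\alpha}{r_0r_1}\Big)\psi_0+\Big(\frac{y}{r_1^2}-\frac{x\cos\alpha}{r_0r_1}\Big)\psi_1,\qquad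 E_\psi(z,w)=\frac{\sin^2\alpha}{N_\psi(\Re(z-w),\Im(z-w))},$$ $$c_\psi=\sin^2\alpha\int_0^{2\pi}\frac{\psi_0\cos\theta+\psi_1\sin\theta}{N_\psi(\cos\theta,\sin\theta)}\,d\theta,\qquad d\sigma_\psi=\psi_0\,dy-\psi_1\,dx .$$ Let $E_{(\vartheta,\varphi)}(Z,W)=E_{(\vartheta_1,\varphi_1)}(z_1,w_1)\mathbf e+E_{(\vartheta_2,\varphi_2)}(z_2,w_2)\mathbf e^\dagger$, $c_{(\vartheta,\varphi)}=c_{(\vartheta_1,\varphi_1)}\mathbf e+c_{(\vartheta_2,\varphi_2)}\mathbf e^\dagger$, $d\sigma_{(\vartheta,\varphi)}(Z)=d\sigma_{(\vartheta_1,\varphi_1)}(z_1)\mathbf e+d\sigma_{(\vartheta_2,\varphi_2)}(z_2)\mathbf e^\dagger$, and $$\frac{\partial}{\partial Z_{\vartheta\varphi}}=\Big(\vartheta_1\frac{\partial}{\partial x_1}+\varphi_1\frac{\partial}{\partial y_1}\Big)\mathbf e+\Big(\vartheta_2\frac{\partial}{\partial x_2}+\varphi_2\frac{\partial}{\partial y_2}\Big)\mathbf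 e^\dagger .$$ *Surface and function.* Let $\Omega_1,\Omega_2\subset\mathbb C$ be open, $\Omega=\Omega_1\mathbf e+\Omega_2\mathbf e^\dagger$, and let $\Gamma\subset\Omega$ be a surface (taken without its boundary) with boundary curve $\gamma\subset\Omega$ such that for $l=1,2$ the projection $\Gamma_l=\{z_l: z_1\mathbf e+z_2\mathbf e^\dagger\in\Gamma\}$ is a bounded simply connected domain in $\mathbb C$, and $\gamma$ is parametrized by $r=r_1\mathbf e+r_2\mathbf e^\dagger$ on $[0,1]$, where $r_l$ is a piecewise continuously differentiable closed Jordan curve that parametrizes $\gamma_l=\partial\Gamma_l$ with positive orientation (winding number $1$ about the points of $\Gamma_l$ and $0$ about the points outside $\overline{\Gamma_l}$). This includes surfaces $R=R_1\mathbf e+R_2\mathbf e^\dagger$ with $R_l$ a parametrization of $\Gamma_l$, and the product $\Gamma_1\mathbf e+\Gamma_2\mathbf e^\dagger$. Let $F(Z)=f_1(z_1)\mathbf e+f_2(z_2)\mathbf e^\dagger$ on $\Omega$ with $f_l\in C^1(\Omega_l,\mathbb C)$. For $G=g_1(z_1)\mathbf e+g_2(z_2)\mathbf e^\dagger$ put $\int_\Gamma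 G\,dZ\wedge dZ^*=\big(\int_{\Gamma_1}g_1\,dz_1\wedge d\bar z_1\big)\mathbf e+\big(\int_{\Gamma_2}g_2\,dz_2\wedge d\bar z_2\big)\mathbf e^\dagger$ with $dz_l\wedge d\bar z_l=-2\mathbf i\,dx_l\,dy_l$; integrals over $\gamma$ are taken along $r$. *Claim.* For every $W\in\Gamma$ the two integrals below converge absolutely and $$F(W)\,c_{(\vartheta,\varphi)}=\int_\gamma F(Z)\,E_{(\vartheta,\varphi)}(Z,W)\,d\sigma_{(\vartheta,\varphi)}(Z)-\frac{\mathbf i}{2}\int_\Gamma E_{(\vartheta,\varphi)}(Z,W)\,\frac{\partial F}{\partial Z_{\vartheta\varphi}}(Z)\,dZ\wedge dZ^* ,$$ where $\frac{\mathbf i}{2}\,dZ\wedge dZ^*$ is the area element $dx_1dy_1\,\mathbf e+dx_2dy_2\,\mathbf e^\dagger$. -/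

import Mathlib

/-- Bicomplex numbers in idempotent coordinates: the pair `(z₁, z₂)` stands for
`z₁ 𝐞 + z₂ 𝐞†`; sum and product are componentwise, and the topology is that of `ℝ⁴`. -/
abbrev Bicomplex : Type := ℂ × ℂ

namespace Bicomplex

noncomputable section

/-- The unit `𝐢`. -/
def unitI : Bicomplex := (Complex.I, Complex.I)

/-- The second unit `𝐣`, commuting with `𝐢`. -/
def unitJ : Bicomplex := (-Complex.I, Complex.I)

/-- The idempotent `𝐞 = (1 + 𝐢𝐣)/2`. -/
def e : Bicomplex := (1, 0)

/-- The idempotent `𝐞† = (1 - 𝐢𝐣)/2`. -/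
def eDag : Bicomplex := (0, 1)

theorem unitI_sq : unitI * unitI = -1 := by
  ext <;> simp [unitI]

theorem unitJ_sq : unitJ * unitJ = -1 := by
  ext <;> simp [unitJ]

theorem e_eq : e = (1 / 2 : ℂ) • (1 + unitI * unitJ) := by
  ext <;> simp [e, unitI, unitJ]; norm_num

theorem eDag_eq : eDag = (1 / 2 : ℂ) • (1 - unitI * unitJ) := by
  ext <;> simp [eDag, unitI, unitJ]; norm_num

theorem idempotent_repr (Z : Bicomplex) : Z = Z.1 • e + Z.2 • eDag := by
  ext <;> simp [e, eDag]

/-- Every bicomplex number is `z₁ + z₂ 𝐣` for exactly one pair of complex numbers. -/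
theorem cartesian_repr (Z : Bicomplex) :
    ∃! p : ℂ × ℂ, Z = p.1 • (1 : Bicomplex) + p.2 • unitJ := by
  have hI := Complex.I_mul_I
  refine ⟨((Z.1 + Z.2) / 2, Complex.I * (Z.1 - Z.2) / 2), ?_, ?_⟩
  · ext1
    · simp [unitJ]; linear_combination (-(Z.1 - Z.2) / 2) * -hI
    · simp [unitJ]; linear_combination ((Z.1 - Z.2) / 2) * -hI
  · rintro ⟨p, q⟩ rfl
    ext1
    · simp [unitJ]; ring
    · simp [unitJ]; linear_combination q * hI

/-! ### The complex weighted kernel -/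

/-- With `r₀ = |ψ₀|`, `r₁ = |ψ₁|` and `α` the angle between `ψ₀` and `ψ₁`:
`(x / r₀² - y cos α / (r₀ r₁)) ψ₀ + (y / r₁² - x cos α / (r₀ r₁)) ψ₁`. -/
def kernelDenom (ψ₀ ψ₁ : ℂ) (x y : ℝ) : ℂ :=
  ((x / ‖ψ₀‖ ^ 2 - y * Real.cos (InnerProductGeometry.angle ψ₀ ψ₁) / (‖ψ₀‖ * ‖ψ₁‖) : ℝ) : ℂ) * ψ₀ +
  ((y / ‖ψ₁‖ ^ 2 - x * Real.cos (InnerProductGeometry.angle ψ₀ ψ₁) / (‖ψ₀‖ * ‖ψ₁‖) : ℝ) : ℂ) * ψ₁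

/-- The `ψ`-Cauchy-type kernel `E_ψ(z, w)` of the constant weights `ψ = (ψ₀, ψ₁)`. -/
def cauchyKernel (ψ₀ ψ₁ z w : ℂ) : ℂ :=
  ((Real.sin (InnerProductGeometry.angle ψ₀ ψ₁) ^ 2 : ℝ) : ℂ) /
    kernelDenom ψ₀ ψ₁ (z - w).re (z - w).im

/-- The constant `c_ψ`. -/
def cauchyConst (ψ₀ ψ₁ : ℂ) : ℂ :=
  ((Real.sin (InnerProductGeometry.angle ψ₀ ψ₁) ^ 2 : ℝ) : ℂ) *
    ∫ θ in (0 : ℝ)..(2 * Real.pi),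
      (ψ₀ * (Real.cos θ : ℂ) + ψ₁ * (Real.sin θ : ℂ)) /
        kernelDenom ψ₀ ψ₁ (Real.cos θ) (Real.sin θ)

/-- The value on the tangent vector `v` of the form `dσ_ψ = ψ₀ dy - ψ₁ dx`. -/
def sigmaForm (ψ₀ ψ₁ v : ℂ) : ℂ := ψ₀ * (v.im : ℂ) - ψ₁ * (v.re : ℂ)

/-! ### The bicomplex weighted objects -/

/-- `E_{(ϑ,φ)}(Z, W)`. -/
def kernel (ϑ φ Z W : Bicomplex) : Bicomplex :=
  cauchyKernel ϑ.1 φ.1 Z.1 W.1 • e + cauchyKernel ϑ.2 φ.2 Z.2 W.2 • eDag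

/-- `c_{(ϑ,φ)}`. -/
def const (ϑ φ : Bicomplex) : Bicomplex :=
  cauchyConst ϑ.1 φ.1 • e + cauchyConst ϑ.2 φ.2 • eDag

/-- The value on the tangent vector `V` of the form `dσ_{(ϑ,φ)}`. -/
def dSigma (ϑ φ V : Bicomplex) : Bicomplex :=
  sigmaForm ϑ.1 φ.1 V.1 • e + sigmaForm ϑ.2 φ.2 V.2 • eDag

/-- The bicomplex weighted Cauchy-Riemann operator
`∂F/∂Z_{ϑφ} = (ϑ₁ ∂F/∂x₁ + φ₁ ∂F/∂y₁) 𝐞 + (ϑ₂ ∂F/∂x₂ + φ₂ ∂F/∂y₂) 𝐞†`,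
where `Z = (x₁ + 𝐢 y₁) 𝐞 + (x₂ + 𝐢 y₂) 𝐞†`. -/
def weightedCR (ϑ φ : Bicomplex) (F : Bicomplex → Bicomplex) (Z : Bicomplex) : Bicomplex :=
  (ϑ.1 • fderiv ℝ F Z e + φ.1 • fderiv ℝ F Z (unitI * e)) * e +
  (ϑ.2 • fderiv ℝ F Z eDag + φ.2 • fderiv ℝ F Z (unitI * eDag)) * eDag

/-! ### Jordan domains and surfaces -/

/-- `r : [0, 1] → ℂ` is piecewise continuously differentiable. -/
def PiecewiseC1 (r : ℝ → ℂ) : Prop :=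
  ∃ (n : ℕ) (t : ℕ → ℝ), t 0 = 0 ∧ t n = 1 ∧ (∀ k < n, t k ≤ t (k + 1)) ∧
    ∀ k < n, ContDiffOn ℝ 1 r (Set.Icc (t k) (t (k + 1)))

/-- The winding number of the closed curve `r : [0, 1] → ℂ` about `z`. -/
def windingNumber (r : ℝ → ℂ) (z : ℂ) : ℂ :=
  (2 * Real.pi * Complex.I)⁻¹ * ∫ t in (0 : ℝ)..1, deriv r t / (r t - z)

/-- `Γ` is a bounded simply connected plane domain whose boundary is the piecewise smooth closed
Jordan curve `r : [0, 1] → ℂ`, positively oriented: `r` winds once around the points of `Γ`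
and does not wind around the points outside. -/
structure IsJordanDomain (Γ : Set ℂ) (r : ℝ → ℂ) : Prop where
  isOpen : IsOpen Γ
  isBounded : Bornology.IsBounded Γ
  simplyConnected : SimplyConnectedSpace Γ
  piecewiseC1 : PiecewiseC1 r
  closed : r 0 = r 1
  injOn : Set.InjOn r (Set.Ico 0 1)
  frontier_eq : frontier Γ = r '' Set.Icc 0 1
  winding_inside : ∀ z ∈ Γ, windingNumber r z = 1
  winding_outside : ∀ z ∉ closure Γ, windingNumber r z = 0

/-- A surface `Γ` (the set `carrier`, without its boundary) in the bicomplex numbers whose two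
idempotent projections are Jordan domains `Γ₁`, `Γ₂`, and whose boundary curve
`r = r₁ 𝐞 + r₂ 𝐞†` on `[0, 1]` has as components parametrizations of `∂Γ₁` and `∂Γ₂`.
This contains each surface `R = R₁ 𝐞 + R₂ 𝐞†` for which `R₁`, `R₂` parametrize `Γ₁`, `Γ₂`,
and also the full product `Γ₁ 𝐞 + Γ₂ 𝐞†`. -/
structure Surface where
  carrier : Set Bicomplex
  bdry : ℝ → Bicomplex
  jordan₁ : IsJordanDomain (Prod.fst '' carrier) (fun t => (bdry t).1)
  jordan₂ : IsJordanDomain (Prod.snd '' carrier) (fun t => (bdry t).2)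

/-- The domain `Γ₁`. -/
def Surface.dom₁ (S : Surface) : Set ℂ := Prod.fst '' S.carrier

/-- The domain `Γ₂`. -/
def Surface.dom₂ (S : Surface) : Set ℂ := Prod.snd '' S.carrier

/-- The integrand of `∫_γ G(Z) dσ_{(ϑ,φ)}(Z)`, pulled back to `[0, 1]`. -/
def Surface.boundaryIntegrand (S : Surface) (ϑ φ : Bicomplex) (G : Bicomplex → Bicomplex)
    (t : ℝ) : Bicomplex :=
  G (S.bdry t) * dSigma ϑ φ (deriv S.bdry t)

/-- `I = ∫_Γ G(Z) dZ ∧ dZ^*`: the function `G` has on `Γ` the form `g₁(z₁) 𝐞 + g₂(z₂) 𝐞†` (which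
determines `g₁` on `Γ₁` and `g₂` on `Γ₂`), both components are integrable, and
`I = (∫_{Γ₁} g₁ dz₁ ∧ dz̄₁) 𝐞 + (∫_{Γ₂} g₂ dz₂ ∧ dz̄₂) 𝐞†`, where `dz ∧ dz̄ = -2𝐢 dx dy`. -/
def Surface.HasAreaIntegral (S : Surface) (G : Bicomplex → Bicomplex) (I : Bicomplex) : Prop :=
  ∃ g₁ g₂ : ℂ → ℂ,
    (∀ Z ∈ S.carrier, G Z = g₁ Z.1 • e + g₂ Z.2 • eDag) ∧
    MeasureTheory.IntegrableOn g₁ S.dom₁ ∧ MeasureTheory.IntegrableOn g₂ S.dom₂ ∧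
    I = (-2 * Complex.I * ∫ z in S.dom₁, g₁ z) • e + (-2 * Complex.I * ∫ z in S.dom₂, g₂ z) • eDag

end

end Bicomplex

/-! The formula is governed by the real-linear map `L v = ψ₀ Im v - ψ₁ Re v` (`sigmaCLM`), injective
because the weights are independent. The kernel is a constant multiple of `1 / L (z - w)`
(`cauchyKernel_eq`), the boundary form is `L (dz)`, and the weighted operator is `crOp L`. In
idempotent coordinates the bicomplex formula is a pair of such plane formulas.

The plane formula is obtained without Green's theorem. For compactly supported `f`, polar
coordinates give `∫ crOp L f / L (z - w) = -C f w` over the whole plane, with `C = circleConst L`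
(`integral_crOp_div`). This is inserted for `f (r t)` in the boundary integral; Fubini and partial
fractions for `1 / (L (z - r) L (r - w))` then leave contour integrals of `L (dr) / L (r - z)`,
which equal `C` for `z` in `Γ` and `0` outside (`circleConst_ne_zero_and_integral`). So the boundary
integral is minus the area integral over the complement of `Γ`, and comparison with the whole-plane
formula finishes (`borelPompeiu_of_compactSupport`). A cutoff function removes the compact support.
-/

namespace BorelPompeiu

open MeasureTheory Set Filter Topology ComplexConjugate

/-! ### Piecewise smooth paths -/

/-- `r` is continuous on `[a, b]` and, off a countable subset of `(a, b)`, differentiable with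
bounded derivative. -/
structure IsDiffPath (r : ℝ → ℂ) (a b : ℝ) : Prop where
  le : a ≤ b
  continuousOn : ContinuousOn r (Icc a b)
  exists_bound : ∃ s : Set ℝ, s.Countable ∧ ∃ M : ℝ, ∀ t ∈ Ioo a b \ s,
    DifferentiableAt ℝ r t ∧ ‖deriv r t‖ ≤ M

theorem exists_mem_Ioc_of_subdivision {t : ℕ → ℝ} {n : ℕ} {x : ℝ} (hx : x ∈ Ioc (t 0) (t n)) :
    ∃ k < n, x ∈ Ioc (t k) (t (k + 1)) := by
  induction n with
  | zero => exact absurd hx.1 (not_lt.2 hx.2)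
  | succ n ih =>
    by_cases h : x ≤ t n
    · obtain ⟨k, hk, hk'⟩ := ih ⟨hx.1, h⟩
      exact ⟨k, hk.trans (Nat.lt_succ_self n), hk'⟩
    · exact ⟨n, Nat.lt_succ_self n, not_le.1 h, hx.2⟩

theorem le_of_subdivision {t : ℕ → ℝ} {n : ℕ} (ht : ∀ k < n, t k ≤ t (k + 1)) : t 0 ≤ t n := by
  induction n with
  | zero => exact le_rfl
  | succ n ih => exact (ih fun k hk => ht k (by omega)).trans (ht n (by omega))

theorem continuousOn_of_subdivision {r : ℝ → ℂ} {t : ℕ → ℝ} {n : ℕ}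
    (ht : ∀ k < n, t k ≤ t (k + 1))
    (hr : ∀ k < n, ContinuousOn r (Icc (t k) (t (k + 1)))) :
    ContinuousOn r (Icc (t 0) (t n)) := by
  induction n with
  | zero => simp
  | succ n ih =>
    rw [← Icc_union_Icc_eq_Icc (le_of_subdivision fun k hk => ht k (by omega)) (ht n (by omega))]
    exact (ih (fun k hk => ht k (by omega)) fun k hk => hr k (by omega)).union_of_isClosed
      (hr n (by omega)) isClosed_Icc isClosed_Icc

theorem deriv_bound_of_contDiffOn {r : ℝ → ℂ} {a b : ℝ} (h : ContDiffOn ℝ 1 r (Icc a b)) :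
    ∃ M : ℝ, ∀ t ∈ Ioo a b, DifferentiableAt ℝ r t ∧ ‖deriv r t‖ ≤ M := by
  rcases lt_or_ge a b with hab | hab
  · obtain ⟨M, hM⟩ := isCompact_Icc.exists_bound_of_continuousOn
      (h.continuousOn_derivWithin (uniqueDiffOn_Icc hab) le_rfl)
    refine ⟨M, fun t ht => ?_⟩
    have hn : Icc a b ∈ 𝓝 t := Icc_mem_nhds ht.1 ht.2
    refine ⟨(h.differentiableOn one_ne_zero t (Ioo_subset_Icc_self ht)).differentiableAt hn, ?_⟩
    rw [← derivWithin_of_mem_nhds hn]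
    exact hM t (Ioo_subset_Icc_self ht)
  · exact ⟨0, fun t ht => absurd (ht.1.trans ht.2) (not_lt.2 hab)⟩

theorem isDiffPath_of_piecewiseC1 {r : ℝ → ℂ} (h : Bicomplex.PiecewiseC1 r) :
    IsDiffPath r 0 1 := by
  obtain ⟨n, t, h0, h1, ht, hr⟩ := h
  refine ⟨zero_le_one, ?_, range t, countable_range t, ?_⟩
  · rw [← h0, ← h1]
    exact continuousOn_of_subdivision ht fun k hk => (hr k hk).continuousOn
  · have H : ∀ k, ∃ M : ℝ, k < n → ∀ x ∈ Ioo (t k) (t (k + 1)),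
        DifferentiableAt ℝ r x ∧ ‖deriv r x‖ ≤ M := by
      intro k
      by_cases hk : k < n
      · obtain ⟨M, hM⟩ := deriv_bound_of_contDiffOn (hr k hk)
        exact ⟨M, fun _ => hM⟩
      · exact ⟨0, fun h => absurd h hk⟩
    choose M hM using H
    -- The sum serves as a common upper bound for the finitely many `M k`.
    refine ⟨∑ k ∈ Finset.range n, |M k|, fun x hx => ?_⟩
    obtain ⟨k, hk, hxk⟩ := exists_mem_Ioc_of_subdivision (t := t) (n := n) (x := x)
      (by rw [h0, h1]; exact Ioo_subset_Ioc_self hx.1)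
    obtain ⟨hd, hb⟩ := hM k hk x ⟨hxk.1, lt_of_le_of_ne hxk.2 fun e => hx.2 ⟨_, e.symm⟩⟩
    exact ⟨hd, hb.trans ((le_abs_self _).trans (Finset.single_le_sum (f := fun k => |M k|)
      (fun _ _ => abs_nonneg _) (Finset.mem_range.2 hk)))⟩

/-- Differentiable maps preserve null sets only between equal dimensions, so `s` is placed on the
real axis of `ℂ`, a null set, and `r` is replaced by `z ↦ r z.re`. -/
theorem volume_image_eq_zero_of_differentiableOn {r : ℝ → ℂ} {s : Set ℝ}
    (h : DifferentiableOn ℝ r s) : volume (r '' s) = 0 := by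
  have h0 : volume ((fun x : ℝ => (x : ℂ)) '' s) = 0 := by
    refine measure_mono_null ?_ (Measure.addHaar_submodule volume
      (LinearMap.range Complex.ofRealCLM.toLinearMap) ?_)
    · rintro _ ⟨x, -, rfl⟩
      exact ⟨x, rfl⟩
    · intro e
      obtain ⟨x, hx⟩ : Complex.I ∈ LinearMap.range Complex.ofRealCLM.toLinearMap := e ▸ trivial
      simpa using congrArg Complex.im hx
  have := addHaar_image_eq_zero_of_differentiableOn_of_addHaar_eq_zero volume
    (s := (fun x : ℝ => (x : ℂ)) '' s) (f := fun z : ℂ => r z.re) ?_ h0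
  · rwa [image_image] at this
  · refine h.comp Complex.reCLM.differentiable.differentiableOn ?_
    rintro _ ⟨x, hx, rfl⟩
    simpa using hx

theorem volume_image_of_piecewiseC1 {r : ℝ → ℂ} (h : Bicomplex.PiecewiseC1 r) :
    volume (r '' Icc 0 1) = 0 := by
  obtain ⟨n, t, h0, h1, ht, hr⟩ := h
  -- The half-open pieces miss the left endpoint `0`.
  refine measure_mono_null (t := r '' {0} ∪ ⋃ k ∈ Iio n, r '' Icc (t k) (t (k + 1))) ?_ ?_
  · rintro _ ⟨x, hx, rfl⟩
    rcases hx.1.eq_or_lt with rfl | h'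
    · exact Or.inl ⟨0, rfl, rfl⟩
    · obtain ⟨k, hk, hxk⟩ := exists_mem_Ioc_of_subdivision (t := t) (n := n) (x := x)
        (by rw [h0, h1]; exact ⟨h', hx.2⟩)
      exact Or.inr (mem_biUnion hk ⟨x, Ioc_subset_Icc_self hxk, rfl⟩)
  · refine measure_union_null (by simp) ((measure_biUnion_null_iff (to_countable _)).2 ?_)
    exact fun k hk => volume_image_eq_zero_of_differentiableOn
      ((hr k hk).differentiableOn one_ne_zero)

namespace IsDiffPath

variable {r : ℝ → ℂ} {a b : ℝ}

theorem sub_const (h : IsDiffPath r a b) (w : ℂ) : IsDiffPath (fun t => r t - w) a b := by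
  obtain ⟨s, hs, M, hM⟩ := h.exists_bound
  refine ⟨h.le, h.continuousOn.sub continuousOn_const, s, hs, M, fun t ht => ?_⟩
  rw [deriv_sub_const]
  exact ⟨(hM t ht).1.sub_const w, (hM t ht).2⟩

theorem ae_bound (h : IsDiffPath r a b) : ∃ M : ℝ, 0 ≤ M ∧
    ∀ᵐ t ∂(volume.restrict (Ioc a b)), DifferentiableAt ℝ r t ∧ ‖deriv r t‖ ≤ M := by
  obtain ⟨s, hs, M, hM⟩ := h.exists_bound
  refine ⟨|M|, abs_nonneg _, ?_⟩
  have h1 : ∀ᵐ t : ℝ, t ∉ s := (measure_eq_zero_iff_ae_notMem).1 (hs.measure_zero _)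
  have h2 : ∀ᵐ t : ℝ, t ≠ b := by simp [ae_iff]
  rw [ae_restrict_iff' measurableSet_Ioc]
  filter_upwards [h1, h2] with t h1 h2 ht
  obtain ⟨h3, h4⟩ := hM t ⟨⟨ht.1, lt_of_le_of_ne ht.2 h2⟩, h1⟩
  exact ⟨h3, h4.trans (le_abs_self _)⟩

theorem intervalIntegrable_deriv (h : IsDiffPath r a b) (L : ℂ →L[ℝ] ℂ) :
    IntervalIntegrable (fun t => L (deriv r t)) volume a b := by
  obtain ⟨M, -, hM⟩ := h.ae_bound
  rw [intervalIntegrable_iff_integrableOn_Ioc_of_le h.le]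
  have : IntegrableOn (deriv r) (Ioc a b) :=
    Measure.integrableOn_of_bounded (M := M) (by simp)
      (measurable_deriv r).aestronglyMeasurable (hM.mono fun t ht => ht.2)
  exact L.integrable_comp this

theorem intervalIntegrable_mul (h : IsDiffPath r a b) (L : ℂ →L[ℝ] ℂ) {g : ℝ → ℂ}
    (hg : ContinuousOn g (Icc a b)) :
    IntervalIntegrable (fun t => g t * L (deriv r t)) volume a b :=
  (h.intervalIntegrable_deriv L).continuousOn_mul (by rwa [uIcc_of_le h.le])

end IsDiffPath

/-! ### Real-linear maps and winding numbers -/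

theorem realLinear_eq (L : ℂ →L[ℝ] ℂ) (z : ℂ) :
    L z = (L 1 - Complex.I * L Complex.I) / 2 * z +
      (L 1 + Complex.I * L Complex.I) / 2 * conj z := by
  have h : L z = z.re * L 1 + z.im * L Complex.I := by
    conv_lhs => rw [show z = z.re • (1 : ℂ) + z.im • Complex.I by simp [Complex.re_add_im],
      map_add, map_smul, map_smul, Complex.real_smul, Complex.real_smul]
  have h1 : z + conj z = 2 * z.re := by rw [Complex.add_conj]; push_cast; ring
  have h2 : z - conj z = 2 * z.im * Complex.I := by rw [Complex.sub_conj]; push_cast; ring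
  rw [h]
  linear_combination (-L 1 / 2) * h1 + (Complex.I * L Complex.I / 2) * h2 +
    (z.im * L Complex.I) * Complex.I_mul_I

/-- If `|A| = |B| ≠ 0`, then `1 - B / A` is a kernel vector; it vanishes when `A = B`, where `I`
takes its place. -/
theorem norm_ne_of_injective {A B : ℂ} (h : ∀ z : ℂ, A * z + B * conj z = 0 → z = 0) :
    ‖A‖ ≠ ‖B‖ := by
  intro hAB
  by_cases hA : A = 0
  · have hB : B = 0 := by simpa [hA] using hAB.symm
    exact one_ne_zero (h 1 (by simp [hA, hB]))
  · by_cases hμ : A = B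
    · exact Complex.I_ne_zero (h Complex.I (by simp [hμ]))
    · have hn : A * conj A = B * conj B := by
        rw [Complex.mul_conj, Complex.mul_conj, Complex.normSq_eq_norm_sq,
          Complex.normSq_eq_norm_sq, hAB]
      have : 1 - B / A = 0 := by
        refine h _ ?_
        have hA' : conj A ≠ 0 := by simpa using hA
        simp only [map_sub, map_one, map_div₀]
        field_simp
        linear_combination hn
      apply hμ
      field_simp at this
      linear_combination this

/-- The quotient `L z / (A z) = 1 + (B / A) (conj z / z)` stays in a disc about `1` of radius less
than `1`. Its principal logarithm is therefore a primitive of the difference of the integrands, and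
the path is closed. -/
theorem IsDiffPath.integral_realLinear_div {r : ℝ → ℂ} {a b : ℝ} (h : IsDiffPath r a b)
    (hr : r a = r b) (h0 : ∀ t ∈ Icc a b, r t ≠ 0) (L : ℂ →L[ℝ] ℂ) {A B : ℂ}
    (hL : ∀ z, L z = A * z + B * conj z) (hAB : ‖B‖ < ‖A‖) :
    ∫ t in a..b, L (deriv r t) / L (r t) = ∫ t in a..b, deriv r t / r t := by
  have hA : A ≠ 0 := norm_pos_iff.1 ((norm_nonneg B).trans_lt hAB)
  have hμ : ∀ z : ℂ, z ≠ 0 → 1 + B / A * (conj z / z) ∈ Complex.slitPlane := by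
    intro z hz
    apply Complex.mem_slitPlane_of_norm_lt_one
    have : ‖z‖ ≠ 0 := norm_ne_zero_iff.2 hz
    rw [norm_mul, norm_div, norm_div, RCLike.norm_conj, div_self this, mul_one]
    exact (div_lt_one (norm_pos_iff.2 hA)).2 hAB
  have hL0 : ∀ z : ℂ, z ≠ 0 → L z ≠ 0 := by
    intro z hz h
    apply Complex.slitPlane_ne_zero (hμ z hz)
    rw [hL] at h
    field_simp
    linear_combination h
  have i1 : IntervalIntegrable (fun t => L (deriv r t) / L (r t)) volume a b := by
    have := h.intervalIntegrable_mul L (g := fun t => (L (r t))⁻¹)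
      ((L.continuous.comp_continuousOn h.continuousOn).inv₀ fun t ht => hL0 _ (h0 t ht))
    simpa only [div_eq_inv_mul] using this
  have i2 : IntervalIntegrable (fun t => deriv r t / r t) volume a b := by
    have := h.intervalIntegrable_mul (.id ℝ ℂ) (g := fun t => (r t)⁻¹)
      (h.continuousOn.inv₀ h0)
    simpa only [div_eq_inv_mul, ContinuousLinearMap.id_apply] using this
  obtain ⟨s, hs, M, hM⟩ := h.exists_bound
  have key := integral_eq_of_hasDerivAt_off_countable
    (fun t => Complex.log (1 + B / A * (conj (r t) / r t)))
    (fun t => L (deriv r t) / L (r t) - deriv r t / r t) (a := a) (b := b) hs ?_ ?_ (i1.sub i2)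
  · rw [intervalIntegral.integral_sub i1 i2, hr, sub_self, sub_eq_zero] at key
    exact key
  · rw [uIcc_of_le h.le]
    refine ContinuousOn.clog ?_ fun t ht => hμ _ (h0 t ht)
    exact continuousOn_const.add (continuousOn_const.mul
      ((Complex.continuous_conj.comp_continuousOn h.continuousOn).div h.continuousOn h0))
  · rw [min_eq_left h.le, max_eq_right h.le]
    intro t ht
    have hrt := h0 t (Ioo_subset_Icc_self ht.1)
    have hd := (hM t ht).1.hasDerivAt
    have hc : HasDerivAt (fun x => conj (r x)) (conj (deriv r t)) t := hd.star
    have := (((hc.div hd hrt).const_mul (B / A)).const_add 1).clog_real (hμ _ hrt)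
    refine this.congr_deriv ?_
    have h1 := hL0 _ hrt
    have h3 : 1 + B / A * (conj (r t) / r t) = L (r t) / (A * r t) := by
      rw [hL]; field_simp
    rw [Pi.div_apply, h3, hL (deriv r t)]
    field_simp
    rw [hL (r t)]
    ring

/-- The integral of `L (dz) / L z` along the positively oriented unit circle. -/
noncomputable def circleConst (L : ℂ →L[ℝ] ℂ) : ℂ :=
  ∫ θ in (0 : ℝ)..(2 * Real.pi),
    L (Complex.I * Complex.exp (θ * Complex.I)) / L (Complex.exp (θ * Complex.I))

theorem hasDerivAt_exp_mul_I (θ : ℝ) :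
    HasDerivAt (fun θ : ℝ => Complex.exp (θ * Complex.I))
      (Complex.I * Complex.exp (θ * Complex.I)) θ := by
  refine (((hasDerivAt_id θ).ofReal_comp).mul_const Complex.I).cexp.congr_deriv ?_
  simp [mul_comm]

theorem isDiffPath_circle :
    IsDiffPath (fun θ : ℝ => Complex.exp (θ * Complex.I)) 0 (2 * Real.pi) := by
  refine ⟨by positivity, by fun_prop, ∅, countable_empty, 1, fun t _ => ?_⟩
  refine ⟨(hasDerivAt_exp_mul_I t).differentiableAt, ?_⟩
  rw [(hasDerivAt_exp_mul_I t).deriv, norm_mul, Complex.norm_exp_ofReal_mul_I]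
  simp

/-- The alternative is whether `L` preserves or reverses orientation. In the reversing case `|A| <
|B|`, and `conj ∘ L` has its coefficients in the right order. -/
theorem realLinear_winding_dichotomy {L : ℂ →L[ℝ] ℂ} (hL : Function.Injective L) :
    (∀ (r : ℝ → ℂ) (a b : ℝ), IsDiffPath r a b → r a = r b → (∀ t ∈ Icc a b, r t ≠ 0) →
      ∫ t in a..b, L (deriv r t) / L (r t) = ∫ t in a..b, deriv r t / r t) ∨
    (∀ (r : ℝ → ℂ) (a b : ℝ), IsDiffPath r a b → r a = r b → (∀ t ∈ Icc a b, r t ≠ 0) →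
      ∫ t in a..b, L (deriv r t) / L (r t) = conj (∫ t in a..b, deriv r t / r t)) := by
  have e := realLinear_eq L
  set A := (L 1 - Complex.I * L Complex.I) / 2
  set B := (L 1 + Complex.I * L Complex.I) / 2
  have hne : ‖A‖ ≠ ‖B‖ := norm_ne_of_injective fun z hz => by
    rw [← e] at hz
    exact hL (by rw [hz, map_zero])
  rcases lt_or_gt_of_ne hne with h | h
  · right
    intro r a b hr hab h0
    rw [← hr.integral_realLinear_div hab h0
      ((Complex.conjCLE : ℂ →L[ℝ] ℂ).comp L) (A := conj B) (B := conj A) ?_ (by simpa using h)]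
    · simp only [intervalIntegral, map_sub, ← integral_conj]
      simp
    · intro z
      simp [e z, add_comm]
  · left
    intro r a b hr hab h0
    exact hr.integral_realLinear_div hab h0 L e h

/-- The same branch of the dichotomy applies to the unit circle and to `r`, so the constant is `2πi`
or its conjugate in both. The number `n` is real so that conjugation fixes it. -/
theorem circleConst_ne_zero_and_integral {L : ℂ →L[ℝ] ℂ} (hL : Function.Injective L) :
    circleConst L ≠ 0 ∧ ∀ (r : ℝ → ℂ) (w : ℂ) (n : ℝ), IsDiffPath r 0 1 → r 0 = r 1 →
      (∀ t ∈ Icc (0 : ℝ) 1, r t ≠ w) → Bicomplex.windingNumber r w = n →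
      ∫ t in (0 : ℝ)..1, L (deriv r t) / L (r t - w) = circleConst L * n := by
  have hc : ∀ x : ℝ, Complex.I * Complex.exp (x * Complex.I) / Complex.exp (x * Complex.I) =
      Complex.I := fun x => mul_div_cancel_right₀ _ (Complex.exp_ne_zero _)
  have hcirc : circleConst L = ∫ t in (0 : ℝ)..(2 * Real.pi),
      L (deriv (fun θ : ℝ => Complex.exp (θ * Complex.I)) t) / L (Complex.exp (t * Complex.I)) := by
    simp only [(hasDerivAt_exp_mul_I _).deriv, circleConst]
  have hwind : ∀ (r : ℝ → ℂ) (w : ℂ) (n : ℝ), Bicomplex.windingNumber r w = n →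
      ∫ t in (0 : ℝ)..1, deriv (fun t => r t - w) t / (r t - w) =
        2 * Real.pi * Complex.I * n := by
    intro r w n h
    simp only [deriv_sub_const]
    rw [← h, Bicomplex.windingNumber, mul_inv_cancel_left₀ Complex.two_pi_I_ne_zero]
  rcases realLinear_winding_dichotomy hL with H | H
  · have h1 : circleConst L = 2 * Real.pi * Complex.I := by
      rw [hcirc, H _ _ _ isDiffPath_circle (by simp) fun t _ => Complex.exp_ne_zero _]
      simp only [(hasDerivAt_exp_mul_I _).deriv, hc]
      simp
    refine ⟨h1 ▸ Complex.two_pi_I_ne_zero, fun r w n hr hcl hw hn => ?_⟩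
    rw [h1, ← hwind r w n hn, ← H _ _ _ (hr.sub_const w) (by rw [hcl])
      fun t ht => sub_ne_zero.2 (hw t ht)]
    simp only [deriv_sub_const]
  · have h1 : circleConst L = conj (2 * Real.pi * Complex.I) := by
      rw [hcirc, H _ _ _ isDiffPath_circle (by simp) fun t _ => Complex.exp_ne_zero _]
      simp only [(hasDerivAt_exp_mul_I _).deriv, hc]
      simp
    refine ⟨h1 ▸ (map_ne_zero _).2 Complex.two_pi_I_ne_zero, fun r w n hr hcl hw hn => ?_⟩
    have h2 := hwind r w n hn
    have h3 := H _ _ _ (hr.sub_const w) (by rw [hcl]) fun t ht => sub_ne_zero.2 (hw t ht)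
    rw [h2, map_mul, Complex.conj_ofReal, ← h1] at h3
    rw [← h3]
    simp only [deriv_sub_const]

/-! ### The formula over the whole plane -/

/-- The first order operator `L(𝐢) ∂/∂x - L(1) ∂/∂y`, which annihilates `L` and hence `1 / L`. -/
noncomputable def crOp (L : ℂ →L[ℝ] ℂ) (f : ℂ → ℂ) (z : ℂ) : ℂ :=
  L Complex.I * fderiv ℝ f z 1 - L 1 * fderiv ℝ f z Complex.I

theorem realLinear_apply_re_im (T : ℂ →L[ℝ] ℂ) (z : ℂ) :
    T z = z.re * T 1 + z.im * T Complex.I := by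
  conv_lhs => rw [show z = z.re • (1 : ℂ) + z.im • Complex.I by simp [Complex.re_add_im],
    map_add, map_smul, map_smul, Complex.real_smul, Complex.real_smul]

/-- Polar form of `crOp`. -/
theorem crOp_polar (L : ℂ →L[ℝ] ℂ) (f : ℂ → ℂ) (z : ℂ) (θ : ℝ) :
    crOp L f z = L (Complex.I * Complex.exp (θ * Complex.I)) *
        fderiv ℝ f z (Complex.exp (θ * Complex.I)) -
      L (Complex.exp (θ * Complex.I)) *
        fderiv ℝ f z (Complex.I * Complex.exp (θ * Complex.I)) := by
  have h : ∀ T : ℂ →L[ℝ] ℂ, T (Complex.exp (θ * Complex.I)) =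
      Real.cos θ * T 1 + Real.sin θ * T Complex.I := fun T => by
    rw [realLinear_apply_re_im T, Complex.exp_ofReal_mul_I_re, Complex.exp_ofReal_mul_I_im]
  have h' : ∀ T : ℂ →L[ℝ] ℂ, T (Complex.I * Complex.exp (θ * Complex.I)) =
      -Real.sin θ * T 1 + Real.cos θ * T Complex.I := fun T => by
    rw [realLinear_apply_re_im T, Complex.I_mul_re, Complex.I_mul_im,
      Complex.exp_ofReal_mul_I_re, Complex.exp_ofReal_mul_I_im, Complex.ofReal_neg]
  have hsc : (Real.cos θ : ℂ) ^ 2 + (Real.sin θ : ℂ) ^ 2 = 1 := by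
    exact_mod_cast Real.cos_sq_add_sin_sq θ
  rw [h, h, h', h', crOp]
  -- The operator is a determinant in the frame `(1, I)`, unchanged when the frame is rotated by
  -- `θ`.
  linear_combination (-(L Complex.I * fderiv ℝ f z 1 - L 1 * fderiv ℝ f z Complex.I)) * hsc

theorem exists_forall_norm_gt_eq_zero {E : Type*} [Zero E] {g : ℂ → E}
    (hg : HasCompactSupport g) : ∃ R : ℝ, 0 ≤ R ∧ ∀ z, R < ‖z‖ → g z = 0 := by
  obtain ⟨R, hR⟩ := hg.isCompact.isBounded.exists_norm_le
  refine ⟨|R|, abs_nonneg _, fun z hz => ?_⟩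
  by_contra h
  exact absurd ((hR z (subset_tsupport _ h)).trans (le_abs_self R)) (not_le.2 hz)

theorem integrableOn_polar {g : ℝ × ℝ → ℂ} (hg : Continuous g) {R : ℝ}
    (hR : ∀ p : ℝ × ℝ, R < p.1 → g p = 0) :
    IntegrableOn g (Ioi 0 ×ˢ Ioo (-Real.pi) Real.pi) := by
  have h : IntegrableOn g (Icc 0 R ×ˢ Icc (-Real.pi) Real.pi) :=
    hg.continuousOn.integrableOn_compact (isCompact_Icc.prod isCompact_Icc)
  refine h.of_forall_sdiff_eq_zero (measurableSet_Ioi.prod measurableSet_Ioo) ?_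
  rintro ⟨x, y⟩ ⟨⟨h1, h2⟩, h3⟩
  apply hR
  by_contra h4
  exact h3 ⟨⟨le_of_lt h1, not_lt.1 h4⟩, Ioo_subset_Icc_self h2⟩

theorem integral_radial {f : ℂ → ℂ} (hf : ContDiff ℝ 1 f) (hs : HasCompactSupport f) {u : ℂ}
    (hu : ‖u‖ = 1) : ∫ ρ in Ioi (0 : ℝ), fderiv ℝ f (ρ * u) u = -f 0 := by
  have hd : ∀ ρ : ℝ, HasDerivAt (fun ρ : ℝ => f (ρ * u)) (fderiv ℝ f (ρ * u) u) ρ := fun ρ => by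
    have h1 : HasDerivAt (fun ρ : ℝ => (ρ : ℂ) * u) u ρ := by
      simpa using ((hasDerivAt_id ρ).ofReal_comp).mul_const u
    exact ((hf.differentiable one_ne_zero _).hasFDerivAt).comp_hasDerivAt ρ h1
  have hc : HasCompactSupport fun ρ : ℝ => f (ρ * u) := by
    obtain ⟨R, -, hR⟩ := exists_forall_norm_gt_eq_zero hs
    refine HasCompactSupport.of_support_subset_isCompact (isCompact_Icc (a := -R) (b := R)) ?_
    intro ρ hρ
    by_contra h
    refine hρ (hR _ ?_)
    rw [norm_mul, hu, mul_one, Complex.norm_real, Real.norm_eq_abs]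
    by_contra h'
    exact h (abs_le.1 (not_lt.1 h'))
  have hcd : ContDiff ℝ 1 fun ρ : ℝ => f (ρ * u) :=
    hf.comp (Complex.ofRealCLM.contDiff.mul contDiff_const)
  have := hc.integral_Ioi_deriv_eq hcd 0
  rw [funext fun ρ => (hd ρ).deriv] at this
  simpa using this

/-- The integrand is the `θ`-derivative of the periodic function `ρ⁻¹ f (ρ e^{iθ})`. -/
theorem integral_angular {f : ℂ → ℂ} (hf : ContDiff ℝ 1 f) {ρ : ℝ} (hρ : 0 < ρ) :
    ∫ θ in Ioo (-Real.pi) Real.pi, fderiv ℝ f (ρ * Complex.exp (θ * Complex.I))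
      (Complex.I * Complex.exp (θ * Complex.I)) = 0 := by
  have hρ' : (ρ : ℂ) ≠ 0 := by exact_mod_cast hρ.ne'
  have hcf := hf.continuous_fderiv one_ne_zero
  have hd : ∀ θ : ℝ, HasDerivAt (fun θ : ℝ => (ρ : ℂ)⁻¹ * f (ρ * Complex.exp (θ * Complex.I)))
      (fderiv ℝ f (ρ * Complex.exp (θ * Complex.I))
        (Complex.I * Complex.exp (θ * Complex.I))) θ := fun θ => by
    have h1 := (hasDerivAt_exp_mul_I θ).const_mul (ρ : ℂ)
    refine ((((hf.differentiable one_ne_zero _).hasFDerivAt).comp_hasDerivAt θ h1).const_mul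
      ((ρ : ℂ)⁻¹)).congr_deriv ?_
    rw [← Complex.real_smul (z := Complex.I * _), map_smul, Complex.real_smul,
      inv_mul_cancel_left₀ hρ']
  rw [← integral_Ioc_eq_integral_Ioo, ← intervalIntegral.integral_of_le (by linarith [Real.pi_pos]),
    intervalIntegral.integral_eq_sub_of_hasDerivAt (fun θ _ => hd θ)]
  · simp [Complex.exp_neg]
  · refine Continuous.intervalIntegrable ?_ _ _
    fun_prop

/-- Periodicity moves the interval to the angular range of `polarCoord`. -/
theorem circleConst_eq_symm (L : ℂ →L[ℝ] ℂ) :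
    circleConst L = ∫ θ in Ioo (-Real.pi) Real.pi,
      L (Complex.I * Complex.exp (θ * Complex.I)) / L (Complex.exp (θ * Complex.I)) := by
  have hp : Function.Periodic (fun θ : ℝ => L (Complex.I * Complex.exp (θ * Complex.I)) /
      L (Complex.exp (θ * Complex.I))) (2 * Real.pi) := by
    intro θ
    have : Complex.exp (((θ + 2 * Real.pi : ℝ) : ℂ) * Complex.I) =
        Complex.exp (θ * Complex.I) := by
      push_cast
      rw [add_mul, Complex.exp_add, Complex.exp_two_pi_mul_I, mul_one]
    simp only [this]
  have h := hp.intervalIntegral_add_eq 0 (-Real.pi)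
  rw [zero_add, show -Real.pi + 2 * Real.pi = Real.pi by ring] at h
  rw [← integral_Ioc_eq_integral_Ioo, ← intervalIntegral.integral_of_le (by linarith [Real.pi_pos]),
    ← h, circleConst]

/-- The Borel-Pompeiu formula in the plane, at the origin. -/
theorem integral_crOp_div_zero {L : ℂ →L[ℝ] ℂ} (hL : Function.Injective L) {f : ℂ → ℂ}
    (hf : ContDiff ℝ 1 f) (hs : HasCompactSupport f) :
    ∫ z, crOp L f z / L z = -(circleConst L * f 0) := by
  have hcf := hf.continuous_fderiv one_ne_zero
  obtain ⟨R, -, hR⟩ := exists_forall_norm_gt_eq_zero (hs.fderiv (𝕜 := ℝ))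
  have hL0 : ∀ θ : ℝ, L (Complex.exp (θ * Complex.I)) ≠ 0 := fun θ h =>
    Complex.exp_ne_zero _ (hL (by rw [h, map_zero]))
  have hexp : ∀ θ : ℝ, (Real.cos θ + Real.sin θ * Complex.I : ℂ) = Complex.exp (θ * Complex.I) :=
    fun θ => by rw [Complex.exp_mul_I, Complex.ofReal_cos, Complex.ofReal_sin]
  have hR' : ∀ p : ℝ × ℝ, R < p.1 → fderiv ℝ f (p.1 * Complex.exp (p.2 * Complex.I)) = 0 := by
    intro p hp
    apply hR
    rw [norm_mul, Complex.norm_exp_ofReal_mul_I, mul_one, Complex.norm_real]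
    exact hp.trans_le (le_abs_self _)
  set G₁ : ℝ × ℝ → ℂ := fun p => L (Complex.I * Complex.exp (p.2 * Complex.I)) /
    L (Complex.exp (p.2 * Complex.I)) *
      fderiv ℝ f (p.1 * Complex.exp (p.2 * Complex.I)) (Complex.exp (p.2 * Complex.I)) with hG₁
  set G₂ : ℝ × ℝ → ℂ := fun p => fderiv ℝ f (p.1 * Complex.exp (p.2 * Complex.I))
    (Complex.I * Complex.exp (p.2 * Complex.I)) with hG₂
  have c₁ : Continuous G₁ := by
    refine Continuous.mul (Continuous.div ?_ ?_ fun p => hL0 p.2) ?_ <;> fun_prop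
  have c₂ : Continuous G₂ := by fun_prop
  have i₁ := integrableOn_polar c₁ (R := R) fun p hp => by simp [hG₁, hR' p hp]
  have i₂ := integrableOn_polar c₂ (R := R) fun p hp => by simp [hG₂, hR' p hp]
  -- The Jacobian `ρ` cancels against `L (ρ e^{iθ}) = ρ L (e^{iθ})`, so the singularity disappears
  -- and a radial and an angular term remain.
  have hG : ∀ p ∈ (Ioi 0 ×ˢ Ioo (-Real.pi) Real.pi : Set (ℝ × ℝ)),
      p.1 • (crOp L f (Complex.polarCoord.symm p) / L (Complex.polarCoord.symm p)) =
        G₁ p - G₂ p := by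
    rintro ⟨ρ, θ⟩ ⟨hρ, -⟩
    have hρ0 : (ρ : ℂ) ≠ 0 := by exact_mod_cast (ne_of_gt hρ)
    have := hL0 θ
    rw [Complex.polarCoord_symm_apply, hexp, crOp_polar L f _ θ, Complex.real_smul]
    simp only [hG₁, hG₂]
    rw [← Complex.real_smul (x := ρ) (z := Complex.exp _), map_smul, Complex.real_smul,
      Complex.real_smul, ← mul_div_assoc, mul_div_mul_left _ _ hρ0,
      sub_div, mul_div_cancel_left₀ _ this, div_mul_eq_mul_div]
  rw [← Complex.integral_comp_polarCoord_symm, polarCoord_target,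
    setIntegral_congr_fun (measurableSet_Ioi.prod measurableSet_Ioo) hG, integral_sub i₁ i₂]
  -- The coefficient depends on `θ` only. Integrating along rays first gives `-f 0`, and the
  -- coefficient then integrates to `circleConst L`.
  have e₁ : ∫ p in Ioi 0 ×ˢ Ioo (-Real.pi) Real.pi, G₁ p = -(circleConst L * f 0) := by
    rw [Measure.volume_eq_prod, ← Measure.prod_restrict, integral_prod_symm]
    · simp only [hG₁, integral_const_mul]
      rw [circleConst_eq_symm, ← mul_neg, ← integral_mul_const]
      refine integral_congr_ae (Eventually.of_forall fun θ => ?_)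
      simp only [integral_radial hf hs (Complex.norm_exp_ofReal_mul_I θ)]
    · rwa [Measure.prod_restrict, ← Measure.volume_eq_prod]
  have e₂ : ∫ p in Ioi 0 ×ˢ Ioo (-Real.pi) Real.pi, G₂ p = 0 := by
    rw [Measure.volume_eq_prod, setIntegral_prod _ i₂]
    refine (setIntegral_congr_fun measurableSet_Ioi fun ρ hρ => ?_).trans (integral_zero' ..)
    exact integral_angular hf hρ
  rw [e₁, e₂, sub_zero]

theorem crOp_comp_add (L : ℂ →L[ℝ] ℂ) (f : ℂ → ℂ) (w z : ℂ) :
    crOp L (fun z => f (z + w)) z = crOp L f (z + w) := by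
  simp only [crOp, fderiv_comp_add_right]

theorem integral_crOp_div {L : ℂ →L[ℝ] ℂ} (hL : Function.Injective L) {f : ℂ → ℂ}
    (hf : ContDiff ℝ 1 f) (hs : HasCompactSupport f) (w : ℂ) :
    ∫ z, crOp L f z / L (z - w) = -(circleConst L * f w) := by
  have h := integral_crOp_div_zero hL (f := fun z => f (z + w))
    (hf.comp (contDiff_id.add contDiff_const)) (hs.comp_homeomorph (Homeomorph.addRight w))
  simp only [crOp_comp_add, zero_add] at h
  rw [← h, ← integral_add_right_eq_self _ w]
  simp only [add_sub_cancel_right]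

/-! ### Integrability of the singular kernel -/

theorem integrable_truncated_inv_norm (R : ℝ) :
    Integrable fun z : ℂ => (Iic R).indicator (fun x : ℝ => x⁻¹) ‖z‖ := by
  rw [integrable_fun_norm_addHaar volume, Complex.finrank_real_complex]
  have h : IntegrableOn (fun _ : ℝ => (1 : ℝ)) (Ioc 0 R) := integrableOn_const (by simp)
  have h' : IntegrableOn ((Iic R).indicator fun _ : ℝ => (1 : ℝ)) (Ioi 0) := by
    rw [integrableOn_indicator_iff measurableSet_Iic]
    rwa [inter_comm, Ioi_inter_Iic]
  refine h'.congr_fun (fun x hx => ?_) measurableSet_Ioi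
  by_cases hR : x ∈ Iic R
  · simp [indicator_of_mem hR, mul_inv_cancel₀ (mem_Ioi.1 hx).ne']
  · simp [hR]

theorem continuous_crOp (L : ℂ →L[ℝ] ℂ) {f : ℂ → ℂ} (hf : ContDiff ℝ 1 f) :
    Continuous (crOp L f) := by
  have hcf := hf.continuous_fderiv one_ne_zero
  unfold crOp
  fun_prop

/-- A bound, uniform for `w` in a ball, of `crOp L f z / L (z - w)` by an integrable function of
`z - w`. -/
theorem exists_crOp_div_bound {L : ℂ →L[ℝ] ℂ} (hL : Function.Injective L) {f : ℂ → ℂ}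
    (hf : ContDiff ℝ 1 f) (hs : HasCompactSupport f) (R₁ : ℝ) :
    ∃ C R : ℝ, ∀ w z : ℂ, ‖w‖ ≤ R₁ → ‖crOp L f z / L (z - w)‖ ≤
      C * (Iic R).indicator (fun x : ℝ => x⁻¹) ‖z - w‖ := by
  obtain ⟨R, -, hR⟩ := exists_forall_norm_gt_eq_zero (hs.fderiv (𝕜 := ℝ))
  have hR' : ∀ z, R < ‖z‖ → crOp L f z = 0 := fun z hz => by simp [crOp, hR z hz]
  obtain ⟨M, hM⟩ := (isCompact_closedBall (0 : ℂ) R).exists_bound_of_continuousOn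
    (continuous_crOp L hf).continuousOn
  -- In finite dimension injectivity yields `‖z‖ ≤ K ‖L z‖`, hence `1 / ‖L z‖ ≤ K / ‖z‖`.
  obtain ⟨K, -, hK⟩ := L.toLinearMap.exists_antilipschitzWith (LinearMap.ker_eq_bot.2 hL)
  have hK' : ∀ z, ‖z‖ ≤ K * ‖L z‖ := fun z => by
    simpa [dist_eq_norm] using hK.le_mul_dist z 0
  -- The numerator vanishes for `‖z‖ > R`; otherwise `‖z - w‖ ≤ R + R₁`.
  refine ⟨|M| * K, R + R₁, fun w z hw => ?_⟩
  by_cases hz : R < ‖z‖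
  · rw [hR' z hz, zero_div, norm_zero]
    refine mul_nonneg (by positivity) ?_
    by_cases h : ‖z - w‖ ∈ Iic (R + R₁)
    · rw [indicator_of_mem h]
      positivity
    · rw [indicator_of_notMem h]
  · have h1 : ‖z - w‖ ∈ Iic (R + R₁) := (norm_sub_le z w).trans (add_le_add (not_lt.1 hz) hw)
    rw [indicator_of_mem h1, norm_div, mul_assoc, div_eq_mul_inv]
    refine mul_le_mul ((hM z (by simpa using hz)).trans (le_abs_self M)) ?_ (by positivity)
      (abs_nonneg M)
    by_cases h0 : z - w = 0
    · simp [h0]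
    · have h2 : 0 < ‖z - w‖ := norm_pos_iff.2 h0
      have h3 : 0 < ‖L (z - w)‖ := norm_pos_iff.2 fun h => h0 (hL (by rw [h, map_zero]))
      rw [inv_le_iff_one_le_mul₀ h3, ← div_eq_mul_inv, div_mul_eq_mul_div, le_div_iff₀ h2, one_mul]
      exact hK' _

theorem integrable_crOp_div {L : ℂ →L[ℝ] ℂ} (hL : Function.Injective L) {f : ℂ → ℂ}
    (hf : ContDiff ℝ 1 f) (hs : HasCompactSupport f) (w : ℂ) :
    Integrable fun z => crOp L f z / L (z - w) := by
  obtain ⟨C, R, h⟩ := exists_crOp_div_bound hL hf hs ‖w‖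
  refine (((integrable_truncated_inv_norm R).comp_sub_right w).const_mul C).mono' ?_
    (Eventually.of_forall fun z => h w z le_rfl)
  have := (continuous_crOp L hf).measurable
  have := L.continuous.measurable
  exact Measurable.aestronglyMeasurable (by fun_prop)

/-- By translation invariance the majorant of the inner area integral does not depend on the pole `r
t`, so only the integrable factor `‖g t‖` is left. -/
theorem integrable_prod_crOp_div {L : ℂ →L[ℝ] ℂ} (hL : Function.Injective L) {f : ℂ → ℂ}
    (hf : ContDiff ℝ 1 f) (hs : HasCompactSupport f) {r g : ℝ → ℂ}
    (hr : ContinuousOn r (Icc 0 1)) (hg : IntegrableOn g (Ioc 0 1)) :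
    Integrable (fun p : ℝ × ℂ => crOp L f p.2 / L (p.2 - r p.1) * g p.1)
      ((volume.restrict (Ioc 0 1)).prod volume) := by
  obtain ⟨R₁, hR₁⟩ := isCompact_Icc.exists_bound_of_continuousOn hr
  obtain ⟨C, R, h⟩ := exists_crOp_div_bound hL hf hs R₁
  have m1 := (continuous_crOp L hf).measurable
  have m2 := L.continuous.measurable
  have m3 : AEMeasurable (fun p : ℝ × ℂ => r p.1)
      ((volume.restrict (Ioc 0 1)).prod volume) :=
    (((hr.mono Ioc_subset_Icc_self).aestronglyMeasurable measurableSet_Ioc).comp_fst).aemeasurable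
  have m4 : AEMeasurable (fun p : ℝ × ℂ => g p.1) ((volume.restrict (Ioc 0 1)).prod volume) :=
    (hg.aestronglyMeasurable.comp_fst).aemeasurable
  have hm : AEStronglyMeasurable (fun p : ℝ × ℂ => crOp L f p.2 / L (p.2 - r p.1) * g p.1)
      ((volume.restrict (Ioc 0 1)).prod volume) :=
    AEMeasurable.aestronglyMeasurable
      (((m1.comp measurable_snd).aemeasurable.div
        (m2.comp_aemeasurable (measurable_snd.aemeasurable.sub m3))).mul m4)
  rw [integrable_prod_iff hm]
  refine ⟨Eventually.of_forall fun t => (integrable_crOp_div hL hf hs (r t)).mul_const (g t), ?_⟩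
  refine Integrable.mono' (g := fun t => C *
    (∫ z : ℂ, (Iic R).indicator (fun x : ℝ => x⁻¹) ‖z‖) * ‖g t‖) (hg.norm.const_mul _)
    hm.norm.integral_prod_right' ?_
  filter_upwards [ae_restrict_mem measurableSet_Ioc] with t ht
  rw [Real.norm_of_nonneg (integral_nonneg fun _ => norm_nonneg _)]
  simp only [norm_mul]
  rw [integral_mul_const]
  refine mul_le_mul_of_nonneg_right ?_ (norm_nonneg _)
  rw [← integral_sub_right_eq_self (fun z : ℂ => (Iic R).indicator (fun x : ℝ => x⁻¹) ‖z‖) (r t),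
    ← integral_const_mul]
  exact integral_mono (integrable_crOp_div hL hf hs (r t)).norm
    (((integrable_truncated_inv_norm R).comp_sub_right (r t)).const_mul C)
    fun z => h _ z (hR₁ t (Ioc_subset_Icc_self ht))

/-! ### The formula on Jordan domains -/

section Jordan

variable {L : ℂ →L[ℝ] ℂ} {Γ : Set ℂ} {r : ℝ → ℂ} {w : ℂ}

theorem ne_of_mem_jordan (hΓ : Bicomplex.IsJordanDomain Γ r) (hw : w ∉ frontier Γ) :
    ∀ t ∈ Icc (0 : ℝ) 1, r t ≠ w := by
  rintro t ht rfl
  exact hw (hΓ.frontier_eq ▸ mem_image_of_mem r ht)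

theorem integral_realLinear_jordan (hL : Function.Injective L)
    (hΓ : Bicomplex.IsJordanDomain Γ r) (hw : w ∉ frontier Γ) :
    ∫ t in (0 : ℝ)..1, L (deriv r t) / L (r t - w) =
      circleConst L * (Γ.indicator 1 w : ℝ) := by
  refine (circleConst_ne_zero_and_integral hL).2 r w _ (isDiffPath_of_piecewiseC1 hΓ.piecewiseC1)
    hΓ.closed (ne_of_mem_jordan hΓ hw) ?_
  by_cases h : w ∈ Γ
  · simp [h, hΓ.winding_inside w h]
  · have : w ∉ closure Γ := fun hc => hw ⟨hc, by rwa [hΓ.isOpen.interior_eq]⟩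
    simp [h, hΓ.winding_outside w this]

theorem notMem_frontier_of_mem (hΓ : Bicomplex.IsJordanDomain Γ r) (hw : w ∈ Γ) :
    w ∉ frontier Γ := fun h => h.2 (by rwa [hΓ.isOpen.interior_eq])

theorem intervalIntegrable_jordan (hL : Function.Injective L)
    (hΓ : Bicomplex.IsJordanDomain Γ r) (hw : w ∉ frontier Γ) :
    IntervalIntegrable (fun t => L (deriv r t) / L (r t - w)) volume 0 1 := by
  have h := isDiffPath_of_piecewiseC1 hΓ.piecewiseC1
  have := h.intervalIntegrable_mul L (g := fun t => (L (r t - w))⁻¹)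
    ((L.continuous.comp_continuousOn (h.continuousOn.sub continuousOn_const)).inv₀
      fun t ht h0 => ne_of_mem_jordan hΓ hw t ht (sub_eq_zero.1 (hL (h0.trans (map_zero L).symm))))
  simpa only [div_eq_inv_mul] using this

theorem borelPompeiu_of_compactSupport (hL : Function.Injective L)
    (hΓ : Bicomplex.IsJordanDomain Γ r) (hw : w ∈ Γ) {f : ℂ → ℂ}
    (hf : ContDiff ℝ 1 f) (hs : HasCompactSupport f) :
    circleConst L * f w = (∫ t in (0 : ℝ)..1, f (r t) * (L (deriv r t) / L (r t - w))) -
      ∫ z in Γ, crOp L f z / L (z - w) := by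
  have hC := (circleConst_ne_zero_and_integral hL).1
  have hw' := notMem_frontier_of_mem hΓ hw
  have hp := isDiffPath_of_piecewiseC1 hΓ.piecewiseC1
  have hL0 : ∀ z : ℂ, z ≠ 0 → L z ≠ 0 := fun z hz h => hz (hL (by rw [h, map_zero]))
  have hg := intervalIntegrable_jordan hL hΓ hw'
  have hg' := (intervalIntegrable_iff_integrableOn_Ioc_of_le zero_le_one).1 hg
  have hi := integrable_crOp_div hL hf hs w
  -- Integrating over `z` first recovers `f (r t)`; integrating over `t` first produces winding
  -- numbers.
  have swap := integral_integral_swap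
    (f := fun t z => crOp L f z / L (z - r t) * (L (deriv r t) / L (r t - w)))
    (integrable_prod_crOp_div hL hf hs hp.continuousOn hg')
  have lhs : ∫ t in Ioc (0 : ℝ) 1, ∫ z, crOp L f z / L (z - r t) *
      (L (deriv r t) / L (r t - w)) =
      -(circleConst L * ∫ t in (0 : ℝ)..1, f (r t) * (L (deriv r t) / L (r t - w))) := by
    rw [intervalIntegral.integral_of_le zero_le_one, ← integral_const_mul, ← integral_neg]
    refine integral_congr_ae (Eventually.of_forall fun t => ?_)
    simp only [integral_mul_const, integral_crOp_div hL hf hs]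
    ring
  -- The contour integral about `z` is known only off the boundary curve, which is a null set.
  have hfr : ∀ᵐ z : ℂ, z ∉ frontier Γ := by
    rw [← measure_eq_zero_iff_ae_notMem, hΓ.frontier_eq]
    exact volume_image_of_piecewiseC1 hΓ.piecewiseC1
  have hwae : ∀ᵐ z : ℂ, z ≠ w := by simp [ae_iff]
  have rhs : ∫ z, ∫ t in Ioc (0 : ℝ) 1, crOp L f z / L (z - r t) *
      (L (deriv r t) / L (r t - w)) =
      circleConst L * ∫ z in Γᶜ, crOp L f z / L (z - w) := by
    rw [← integral_indicator hΓ.isOpen.measurableSet.compl, ← integral_const_mul]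
    refine integral_congr_ae ?_
    filter_upwards [hfr, hwae] with z hz hzw
    -- Partial fractions, from `L (z - w) = L (z - r t) + L (r t - w)`.
    have e : ∀ t ∈ Ioc (0 : ℝ) 1, crOp L f z / L (z - r t) * (L (deriv r t) / L (r t - w)) =
        crOp L f z / L (z - w) *
          (L (deriv r t) / L (r t - w) - L (deriv r t) / L (r t - z)) := by
      intro t ht
      have h1 := hL0 _ (sub_ne_zero.2 (ne_of_mem_jordan hΓ hz t (Ioc_subset_Icc_self ht)))
      have h2 := hL0 _ (sub_ne_zero.2 (ne_of_mem_jordan hΓ hw' t (Ioc_subset_Icc_self ht)))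
      have h3 := hL0 _ (sub_ne_zero.2 hzw)
      have h4 : L (z - r t) ≠ 0 := by rwa [← neg_sub, map_neg, neg_ne_zero]
      have h5 : L (r t - z) = -L (z - r t) := by rw [← map_neg, neg_sub]
      have h6 : L (z - w) = L (z - r t) + L (r t - w) := by rw [← map_add, sub_add_sub_cancel]
      rw [h5]
      field_simp
      rw [h6]
      ring
    rw [setIntegral_congr_fun measurableSet_Ioc e, integral_const_mul,
      ← intervalIntegral.integral_of_le zero_le_one,
      intervalIntegral.integral_sub hg (intervalIntegrable_jordan hL hΓ hz),
      integral_realLinear_jordan hL hΓ hw', integral_realLinear_jordan hL hΓ hz]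
    -- Since `w ∈ Γ`, the two contour integrals cancel for `z ∈ Γ`, and their difference is
    -- `circleConst L` outside.
    by_cases h : z ∈ Γ
    · simp [h, hw]
    · simp [h, hw, mul_comm]
  have split := integral_add_compl hΓ.isOpen.measurableSet hi
  rw [lhs, rhs] at swap
  rw [integral_crOp_div hL hf hs w] at split
  apply mul_left_cancel₀ hC
  linear_combination circleConst L * split + swap

/-- Since `Γ` is open, agreement on its closure gives equal derivatives on `Γ` and equal values on
the boundary curve. -/
theorem borelPompeiu_of_eqOn (hL : Function.Injective L)
    (hΓ : Bicomplex.IsJordanDomain Γ r) (hw : w ∈ Γ) {f h : ℂ → ℂ}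
    (hh : ContDiff ℝ 1 h) (hs : HasCompactSupport h) (hfh : EqOn h f (closure Γ)) :
    IntegrableOn (fun z => crOp L f z / L (z - w)) Γ ∧
    circleConst L * f w = (∫ t in (0 : ℝ)..1, f (r t) * (L (deriv r t) / L (r t - w))) -
      ∫ z in Γ, crOp L f z / L (z - w) := by
  have e : EqOn (fun z => crOp L h z / L (z - w)) (fun z => crOp L f z / L (z - w)) Γ := by
    intro z hz
    have : h =ᶠ[𝓝 z] f := by
      filter_upwards [hΓ.isOpen.mem_nhds hz] with y hy using hfh (subset_closure hy)
    simp only [crOp, this.fderiv_eq]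
  refine ⟨(integrable_crOp_div hL hh hs w).integrableOn.congr_fun e hΓ.isOpen.measurableSet, ?_⟩
  rw [← setIntegral_congr_fun hΓ.isOpen.measurableSet e, ← hfh (subset_closure hw),
    borelPompeiu_of_compactSupport hL hΓ hw hh hs]
  congr 1
  refine intervalIntegral.integral_congr fun t ht => ?_
  rw [uIcc_of_le zero_le_one] at ht
  have : r t ∈ closure Γ := frontier_subset_closure (hΓ.frontier_eq ▸ mem_image_of_mem r ht)
  simp only [hfh this]

end Jordan

/-- A `C¹` function on an open set agrees near a compact subset with a compactly supported `C¹`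
function. -/
theorem exists_contDiff_hasCompactSupport_eqOn {K Ω : Set ℂ} (hK : IsCompact K) (hΩ : IsOpen Ω)
    (hKΩ : K ⊆ Ω) {f : ℂ → ℂ} (hf : ContDiffOn ℝ 1 f Ω) :
    ∃ h : ℂ → ℂ, ContDiff ℝ 1 h ∧ HasCompactSupport h ∧ EqOn h f K := by
  obtain ⟨K', hK', hKK', hK'Ω⟩ := exists_compact_between hK hΩ hKΩ
  obtain ⟨χ, h1, h0, -⟩ := exists_contMDiffMap_one_nhds_of_subset_interior
    (modelWithCornersSelf ℝ ℂ) (n := 1) hK.isClosed hKK'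
  have hχ : ContDiff ℝ 1 χ := χ.contMDiff.contDiff
  refine ⟨fun z => χ z • f z, contDiff_iff_contDiffAt.2 fun z => ?_, ?_, fun z hz => ?_⟩
  · by_cases hz : z ∈ Ω
    · exact hχ.contDiffAt.smul (hf.contDiffAt (hΩ.mem_nhds hz))
    · refine (contDiffAt_const (c := (0 : ℂ))).congr_of_eventuallyEq ?_
      filter_upwards [hK'.isClosed.isOpen_compl.mem_nhds fun h => hz (hK'Ω h)] with y hy
      rw [h0 y hy, zero_smul]
  · exact HasCompactSupport.intro hK' fun z hz => by rw [h0 z hz, zero_smul]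
  · simp only [h1.self_of_nhdsSet z hz, one_smul]

theorem borelPompeiu_plane {L : ℂ →L[ℝ] ℂ} {Γ Ω : Set ℂ} {r : ℝ → ℂ} {w : ℂ}
    (hL : Function.Injective L) (hΓ : Bicomplex.IsJordanDomain Γ r) (hw : w ∈ Γ)
    (hΩ : IsOpen Ω) (hΓΩ : closure Γ ⊆ Ω) {f : ℂ → ℂ} (hf : ContDiffOn ℝ 1 f Ω) :
    IntervalIntegrable (fun t => f (r t) * (L (deriv r t) / L (r t - w))) volume 0 1 ∧
    IntegrableOn (fun z => crOp L f z / L (z - w)) Γ ∧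
    circleConst L * f w = (∫ t in (0 : ℝ)..1, f (r t) * (L (deriv r t) / L (r t - w))) -
      ∫ z in Γ, crOp L f z / L (z - w) := by
  obtain ⟨h, hh, hs, hfh⟩ := exists_contDiff_hasCompactSupport_eqOn
    hΓ.isBounded.isCompact_closure hΩ hΓΩ hf
  refine ⟨?_, borelPompeiu_of_eqOn hL hΓ hw hh hs hfh⟩
  refine (intervalIntegrable_jordan hL hΓ (notMem_frontier_of_mem hΓ hw)).continuousOn_mul ?_
  rw [uIcc_of_le zero_le_one]
  refine hf.continuousOn.comp (isDiffPath_of_piecewiseC1 hΓ.piecewiseC1).continuousOn fun t ht => ?_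
  exact hΓΩ (frontier_subset_closure (hΓ.frontier_eq ▸ mem_image_of_mem r ht))

/-! ### The weighted kernel as the reciprocal of a linear form -/

/-- `Bicomplex.sigmaForm` as a continuous real-linear map. -/
noncomputable def sigmaCLM (ψ₀ ψ₁ : ℂ) : ℂ →L[ℝ] ℂ :=
  ψ₀ • (Complex.ofRealCLM.comp Complex.imCLM) - ψ₁ • (Complex.ofRealCLM.comp Complex.reCLM)

theorem sigmaCLM_apply (ψ₀ ψ₁ v : ℂ) : sigmaCLM ψ₀ ψ₁ v = Bicomplex.sigmaForm ψ₀ ψ₁ v := by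
  simp [sigmaCLM, Bicomplex.sigmaForm]

variable {ψ₀ ψ₁ : ℂ}

theorem sigmaCLM_injective (h : LinearIndependent ℝ ![ψ₀, ψ₁]) :
    Function.Injective (sigmaCLM ψ₀ ψ₁) := by
  rw [injective_iff_map_eq_zero]
  intro z hz
  rw [sigmaCLM_apply, Bicomplex.sigmaForm] at hz
  obtain ⟨h1, h2⟩ := LinearIndependent.pair_iff.1 h z.im (-z.re) (by
    simp only [Complex.real_smul, Complex.ofReal_neg]
    linear_combination hz)
  exact Complex.ext (neg_eq_zero.1 h2) h1

/-- This is the determinant of `(ψ₀, ψ₁)`. Its vanishing would give real relations with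
`ψ₁`-coefficients `-Re ψ₀` and `-Im ψ₀`, forcing `ψ₀ = 0`. -/
theorem im_conj_mul_ne_zero (h : LinearIndependent ℝ ![ψ₀, ψ₁]) : (conj ψ₀ * ψ₁).im ≠ 0 := by
  intro hd
  have hne : ψ₀ ≠ 0 := h.ne_zero 0
  have h' : ψ₀.re * ψ₁.im - ψ₀.im * ψ₁.re = 0 := by
    simp at hd
    linarith
  have h1 := LinearIndependent.pair_iff.1 h ψ₁.re (-ψ₀.re) (by
    apply Complex.ext
    · simp; ring
    · simp; linarith)
  have h2 := LinearIndependent.pair_iff.1 h ψ₁.im (-ψ₀.im) (by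
    apply Complex.ext
    · simp; linarith
    · simp; ring)
  exact hne (Complex.ext (neg_eq_zero.1 h1.2) (neg_eq_zero.1 h2.2))

/-- The factor in `E_ψ(z, w) = κ / (ψ₀ Im (z - w) - ψ₁ Re (z - w))`. -/
noncomputable def kernelFactor (ψ₀ ψ₁ : ℂ) : ℂ := -Complex.I * (conj ψ₀ * ψ₁).im

theorem sin_sq_angle (h0 : ψ₀ ≠ 0) (h1 : ψ₁ ≠ 0) :
    Real.sin (InnerProductGeometry.angle ψ₀ ψ₁) ^ 2 =
      (conj ψ₀ * ψ₁).im ^ 2 / (‖ψ₀‖ ^ 2 * ‖ψ₁‖ ^ 2) := by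
  have h0' := norm_ne_zero_iff.2 h0
  have h1' := norm_ne_zero_iff.2 h1
  rw [Real.sin_sq, InnerProductGeometry.cos_angle, Complex.inner]
  field_simp
  rw [Complex.sq_norm, Complex.sq_norm, Complex.normSq_apply, Complex.normSq_apply]
  simp
  ring

/-- With `c = conj ψ₀ * ψ₁`, one has `|ψ₁|² ψ₀ = conj c * ψ₁` and `|ψ₀|² ψ₁ = c * ψ₀`. Subtracting
the `Re c` terms leaves `i Im c (y ψ₀ - x ψ₁)`, divided by `|ψ₀|² |ψ₁|²`. -/
theorem kernelDenom_mul (h0 : ψ₀ ≠ 0) (h1 : ψ₁ ≠ 0) (x y : ℝ) :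
    Bicomplex.kernelDenom ψ₀ ψ₁ x y * kernelFactor ψ₀ ψ₁ =
      (Real.sin (InnerProductGeometry.angle ψ₀ ψ₁) ^ 2 : ℝ) * (ψ₀ * y - ψ₁ * x) := by
  have h0' := norm_ne_zero_iff.2 h0
  have h1' := norm_ne_zero_iff.2 h1
  have e1 : x / ‖ψ₀‖ ^ 2 - y * Real.cos (InnerProductGeometry.angle ψ₀ ψ₁) / (‖ψ₀‖ * ‖ψ₁‖) =
      (x * ‖ψ₁‖ ^ 2 - y * (conj ψ₀ * ψ₁).re) / (‖ψ₀‖ ^ 2 * ‖ψ₁‖ ^ 2) := by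
    rw [InnerProductGeometry.cos_angle, Complex.inner]
    field_simp
  have e2 : y / ‖ψ₁‖ ^ 2 - x * Real.cos (InnerProductGeometry.angle ψ₀ ψ₁) / (‖ψ₀‖ * ‖ψ₁‖) =
      (y * ‖ψ₀‖ ^ 2 - x * (conj ψ₀ * ψ₁).re) / (‖ψ₀‖ ^ 2 * ‖ψ₁‖ ^ 2) := by
    rw [InnerProductGeometry.cos_angle, Complex.inner]
    field_simp
  have core : (((x * ‖ψ₁‖ ^ 2 - y * (conj ψ₀ * ψ₁).re : ℝ) : ℂ) * ψ₀ +
      ((y * ‖ψ₀‖ ^ 2 - x * (conj ψ₀ * ψ₁).re : ℝ) : ℂ) * ψ₁) * kernelFactor ψ₀ ψ₁ =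
      (((conj ψ₀ * ψ₁).im ^ 2 : ℝ) : ℂ) * (ψ₀ * y - ψ₁ * x) := by
    rw [kernelFactor, Complex.sq_norm, Complex.sq_norm, Complex.normSq_apply,
      Complex.normSq_apply, pow_two]
    apply Complex.ext
    · simp
      ring
    · simp
      ring
  rw [Bicomplex.kernelDenom, e1, e2, sin_sq_angle h0 h1, Complex.ofReal_div,
    Complex.ofReal_div, Complex.ofReal_div]
  linear_combination (1 / ((‖ψ₀‖ ^ 2 * ‖ψ₁‖ ^ 2 : ℝ) : ℂ)) * core

theorem sin_sq_div_kernelDenom (h : LinearIndependent ℝ ![ψ₀, ψ₁]) (z : ℂ) :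
    ((Real.sin (InnerProductGeometry.angle ψ₀ ψ₁) ^ 2 : ℝ) : ℂ) /
      Bicomplex.kernelDenom ψ₀ ψ₁ z.re z.im = kernelFactor ψ₀ ψ₁ / sigmaCLM ψ₀ ψ₁ z := by
  have h0 : ψ₀ ≠ 0 := h.ne_zero 0
  have h1 : ψ₁ ≠ 0 := h.ne_zero 1
  have hd := im_conj_mul_ne_zero h
  have hκ : kernelFactor ψ₀ ψ₁ ≠ 0 :=
    mul_ne_zero (neg_ne_zero.2 Complex.I_ne_zero) (Complex.ofReal_ne_zero.2 hd)
  have hs : ((Real.sin (InnerProductGeometry.angle ψ₀ ψ₁) ^ 2 : ℝ) : ℂ) ≠ 0 := by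
    rw [sin_sq_angle h0 h1]
    exact Complex.ofReal_ne_zero.2 (div_ne_zero (pow_ne_zero 2 hd) (mul_ne_zero
      (pow_ne_zero 2 (norm_ne_zero_iff.2 h0)) (pow_ne_zero 2 (norm_ne_zero_iff.2 h1))))
  have key := kernelDenom_mul h0 h1 z.re z.im
  rw [sigmaCLM_apply, Bicomplex.sigmaForm]
  -- At the pole both denominators vanish, and both quotients are `0` by convention.
  by_cases hσ : ψ₀ * z.im - ψ₁ * z.re = 0
  · rw [hσ, mul_zero] at key
    rw [hσ, (mul_eq_zero.1 key).resolve_right hκ, div_zero, div_zero]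
  · have hN : Bicomplex.kernelDenom ψ₀ ψ₁ z.re z.im ≠ 0 := by
      intro hN
      rw [hN, zero_mul] at key
      exact mul_ne_zero hs hσ key.symm
    rw [div_eq_div_iff hN hσ, ← key, mul_comm]

theorem cauchyKernel_eq (h : LinearIndependent ℝ ![ψ₀, ψ₁]) (z w : ℂ) :
    Bicomplex.cauchyKernel ψ₀ ψ₁ z w = kernelFactor ψ₀ ψ₁ / sigmaCLM ψ₀ ψ₁ (z - w) :=
  sin_sq_div_kernelDenom h (z - w)

/-- The numerator `ψ₀ cos θ + ψ₁ sin θ` is the form evaluated on the circle's tangent `i e^{iθ}`. -/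
theorem cauchyConst_eq (h : LinearIndependent ℝ ![ψ₀, ψ₁]) :
    Bicomplex.cauchyConst ψ₀ ψ₁ = kernelFactor ψ₀ ψ₁ * circleConst (sigmaCLM ψ₀ ψ₁) := by
  rw [Bicomplex.cauchyConst, circleConst, ← intervalIntegral.integral_const_mul,
    ← intervalIntegral.integral_const_mul]
  refine intervalIntegral.integral_congr fun θ _ => ?_
  have key := sin_sq_div_kernelDenom h (Complex.exp (θ * Complex.I))
  have e : sigmaCLM ψ₀ ψ₁ (Complex.I * Complex.exp (θ * Complex.I)) =
      ψ₀ * (Real.cos θ : ℂ) + ψ₁ * (Real.sin θ : ℂ) := by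
    rw [sigmaCLM_apply, Bicomplex.sigmaForm, Complex.I_mul_re, Complex.I_mul_im,
      Complex.exp_ofReal_mul_I_re, Complex.exp_ofReal_mul_I_im]
    push_cast
    ring
  rw [Complex.exp_ofReal_mul_I_re, Complex.exp_ofReal_mul_I_im] at key
  simp only [e]
  rw [mul_div_left_comm, key]
  ring

theorem crOp_sigmaCLM (f : ℂ → ℂ) (z : ℂ) :
    crOp (sigmaCLM ψ₀ ψ₁) f z = ψ₀ * fderiv ℝ f z 1 + ψ₁ * fderiv ℝ f z Complex.I := by
  simp [crOp, sigmaCLM_apply, Bicomplex.sigmaForm]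

/-- The complex weighted Borel-Pompeiu formula. -/
theorem weighted_borelPompeiu {Γ Ω : Set ℂ} {r : ℝ → ℂ} {w : ℂ}
    (h : LinearIndependent ℝ ![ψ₀, ψ₁]) (hΓ : Bicomplex.IsJordanDomain Γ r) (hw : w ∈ Γ)
    (hΩ : IsOpen Ω) (hΓΩ : closure Γ ⊆ Ω) {f : ℂ → ℂ} (hf : ContDiffOn ℝ 1 f Ω) :
    IntervalIntegrable (fun t => f (r t) * Bicomplex.cauchyKernel ψ₀ ψ₁ (r t) w *
      Bicomplex.sigmaForm ψ₀ ψ₁ (deriv r t)) volume 0 1 ∧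
    IntegrableOn (fun z => Bicomplex.cauchyKernel ψ₀ ψ₁ z w *
      (ψ₀ * fderiv ℝ f z 1 + ψ₁ * fderiv ℝ f z Complex.I)) Γ ∧
    f w * Bicomplex.cauchyConst ψ₀ ψ₁ =
      (∫ t in (0 : ℝ)..1, f (r t) * Bicomplex.cauchyKernel ψ₀ ψ₁ (r t) w *
        Bicomplex.sigmaForm ψ₀ ψ₁ (deriv r t)) -
      ∫ z in Γ, Bicomplex.cauchyKernel ψ₀ ψ₁ z w *
        (ψ₀ * fderiv ℝ f z 1 + ψ₁ * fderiv ℝ f z Complex.I) := by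
  obtain ⟨h1, h2, h3⟩ := borelPompeiu_plane (sigmaCLM_injective h) hΓ hw hΩ hΓΩ hf
  have e1 : (fun t => f (r t) * Bicomplex.cauchyKernel ψ₀ ψ₁ (r t) w *
      Bicomplex.sigmaForm ψ₀ ψ₁ (deriv r t)) = fun t => kernelFactor ψ₀ ψ₁ *
        (f (r t) * (sigmaCLM ψ₀ ψ₁ (deriv r t) / sigmaCLM ψ₀ ψ₁ (r t - w))) := by
    funext t
    rw [cauchyKernel_eq h, ← sigmaCLM_apply]
    ring
  have e2 : (fun z => Bicomplex.cauchyKernel ψ₀ ψ₁ z w *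
      (ψ₀ * fderiv ℝ f z 1 + ψ₁ * fderiv ℝ f z Complex.I)) = fun z => kernelFactor ψ₀ ψ₁ *
        (crOp (sigmaCLM ψ₀ ψ₁) f z / sigmaCLM ψ₀ ψ₁ (z - w)) := by
    funext z
    rw [cauchyKernel_eq h, ← crOp_sigmaCLM]
    ring
  rw [e1, e2, intervalIntegral.integral_const_mul, integral_const_mul, cauchyConst_eq h]
  refine ⟨h1.const_mul _, h2.const_mul _, ?_⟩
  linear_combination kernelFactor ψ₀ ψ₁ * h3

/-! ### Passage to bicomplex numbers -/

theorem closure_subset_of_jordan {Γ Ω : Set ℂ} {r : ℝ → ℂ} (hΓ : Bicomplex.IsJordanDomain Γ r)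
    (hΓΩ : Γ ⊆ Ω) (hr : ∀ t ∈ Icc (0 : ℝ) 1, r t ∈ Ω) : closure Γ ⊆ Ω := by
  rw [closure_eq_self_union_frontier, hΓ.frontier_eq]
  refine union_subset hΓΩ ?_
  rintro _ ⟨t, ht, rfl⟩
  exact hr t ht

theorem weightedCR_eq {Ω₁ Ω₂ : Set ℂ} (hΩ₁ : IsOpen Ω₁) (hΩ₂ : IsOpen Ω₂) (ϑ φ : Bicomplex)
    {f₁ f₂ : ℂ → ℂ} (hf₁ : DifferentiableOn ℝ f₁ Ω₁) (hf₂ : DifferentiableOn ℝ f₂ Ω₂)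
    {F : Bicomplex → Bicomplex}
    (hF : ∀ Z ∈ Ω₁ ×ˢ Ω₂, F Z = f₁ Z.1 • Bicomplex.e + f₂ Z.2 • Bicomplex.eDag)
    {Z : Bicomplex} (hZ : Z ∈ Ω₁ ×ˢ Ω₂) :
    Bicomplex.weightedCR ϑ φ F Z =
      (ϑ.1 * fderiv ℝ f₁ Z.1 1 + φ.1 * fderiv ℝ f₁ Z.1 Complex.I,
        ϑ.2 * fderiv ℝ f₂ Z.2 1 + φ.2 * fderiv ℝ f₂ Z.2 Complex.I) := by
  have e : F =ᶠ[𝓝 Z] fun Z => (f₁ Z.1, f₂ Z.2) := by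
    filter_upwards [(hΩ₁.prod hΩ₂).mem_nhds hZ] with Y hY
    rw [hF Y hY]
    simp [Bicomplex.e, Bicomplex.eDag]
  have d : HasFDerivAt (fun Z : ℂ × ℂ => (f₁ Z.1, f₂ Z.2))
      (((fderiv ℝ f₁ Z.1).comp (.fst ℝ ℂ ℂ)).prod ((fderiv ℝ f₂ Z.2).comp (.snd ℝ ℂ ℂ))) Z :=
    ((hf₁.differentiableAt (hΩ₁.mem_nhds hZ.1)).hasFDerivAt.comp Z hasFDerivAt_fst).prodMk
      ((hf₂.differentiableAt (hΩ₂.mem_nhds hZ.2)).hasFDerivAt.comp Z hasFDerivAt_snd)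
  rw [Bicomplex.weightedCR, e.fderiv_eq, d.fderiv]
  simp [Bicomplex.e, Bicomplex.eDag, Bicomplex.unitI]

/-- The derivative of the pair splits wherever both components are differentiable. At a corner of
just one component, `deriv S.bdry` is `0` while the other component may have a nonzero derivative,
so the equality is stated almost everywhere. -/
theorem boundaryIntegrand_ae_eq (S : Bicomplex.Surface) (ϑ φ : Bicomplex)
    (G : Bicomplex → Bicomplex) :
    ∀ᵐ t ∂(volume.restrict (Ioc (0 : ℝ) 1)), S.boundaryIntegrand ϑ φ G t =
      ((G (S.bdry t)).1 * Bicomplex.sigmaForm ϑ.1 φ.1 (deriv (fun t => (S.bdry t).1) t),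
        (G (S.bdry t)).2 * Bicomplex.sigmaForm ϑ.2 φ.2 (deriv (fun t => (S.bdry t).2) t)) := by
  obtain ⟨_, -, h1⟩ := (isDiffPath_of_piecewiseC1 S.jordan₁.piecewiseC1).ae_bound
  obtain ⟨_, -, h2⟩ := (isDiffPath_of_piecewiseC1 S.jordan₂.piecewiseC1).ae_bound
  filter_upwards [h1, h2] with t h1 h2
  have := (h1.1.hasDerivAt.prodMk h2.1.hasDerivAt).deriv
  rw [Bicomplex.Surface.boundaryIntegrand]
  change G (S.bdry t) * Bicomplex.dSigma ϑ φ
    (deriv (fun t => ((S.bdry t).1, (S.bdry t).2)) t) = _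
  rw [this]
  ext <;> simp [Bicomplex.dSigma, Bicomplex.e, Bicomplex.eDag]

end BorelPompeiu

open BorelPompeiu MeasureTheory Set Filter in
theorem mainTheorem3
    (Ω₁ Ω₂ : Set ℂ) (hΩ₁ : IsOpen Ω₁) (hΩ₂ : IsOpen Ω₂)
    (S : Bicomplex.Surface)
    (hS : S.carrier ⊆ Ω₁ ×ˢ Ω₂)
    (hγ : ∀ t ∈ Set.Icc (0 : ℝ) 1, S.bdry t ∈ Ω₁ ×ˢ Ω₂)
    (ϑ φ : Bicomplex)
    (h₁ : LinearIndependent ℝ ![ϑ.1, φ.1]) (h₂ : LinearIndependent ℝ ![ϑ.2, φ.2])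
    (f₁ f₂ : ℂ → ℂ) (hf₁ : ContDiffOn ℝ 1 f₁ Ω₁) (hf₂ : ContDiffOn ℝ 1 f₂ Ω₂)
    (F : Bicomplex → Bicomplex)
    (hF : ∀ Z ∈ Ω₁ ×ˢ Ω₂, F Z = f₁ Z.1 • Bicomplex.e + f₂ Z.2 • Bicomplex.eDag)
    (W : Bicomplex) (hW : W ∈ S.carrier) :
    IntervalIntegrable
      (S.boundaryIntegrand ϑ φ (fun Z => F Z * Bicomplex.kernel ϑ φ Z W))
      MeasureTheory.volume 0 1 ∧
    ∃ A : Bicomplex,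
      S.HasAreaIntegral
        (fun Z => Bicomplex.kernel ϑ φ Z W * Bicomplex.weightedCR ϑ φ F Z) A ∧
      F W * Bicomplex.const ϑ φ =
        (∫ t in (0 : ℝ)..1,
          S.boundaryIntegrand ϑ φ (fun Z => F Z * Bicomplex.kernel ϑ φ Z W) t) -
        (Complex.I / 2) • A := by
  obtain ⟨b₁, a₁, e₁⟩ := weighted_borelPompeiu h₁ S.jordan₁ (mem_image_of_mem _ hW) hΩ₁
    (closure_subset_of_jordan S.jordan₁ (by rintro _ ⟨Z, hZ, rfl⟩; exact (hS hZ).1)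
      fun t ht => (hγ t ht).1) hf₁
  obtain ⟨b₂, a₂, e₂⟩ := weighted_borelPompeiu h₂ S.jordan₂ (mem_image_of_mem _ hW) hΩ₂
    (closure_subset_of_jordan S.jordan₂ (by rintro _ ⟨Z, hZ, rfl⟩; exact (hS hZ).2)
      fun t ht => (hγ t ht).2) hf₂
  have hI : S.boundaryIntegrand ϑ φ (fun Z => F Z * Bicomplex.kernel ϑ φ Z W)
      =ᵐ[volume.restrict (Ioc 0 1)] fun t =>
      (f₁ (S.bdry t).1 * Bicomplex.cauchyKernel ϑ.1 φ.1 (S.bdry t).1 W.1 *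
        Bicomplex.sigmaForm ϑ.1 φ.1 (deriv (fun t => (S.bdry t).1) t),
       f₂ (S.bdry t).2 * Bicomplex.cauchyKernel ϑ.2 φ.2 (S.bdry t).2 W.2 *
        Bicomplex.sigmaForm ϑ.2 φ.2 (deriv (fun t => (S.bdry t).2) t)) := by
    filter_upwards [boundaryIntegrand_ae_eq S ϑ φ fun Z => F Z * Bicomplex.kernel ϑ φ Z W,
      ae_restrict_mem measurableSet_Ioc] with t ht hm
    rw [ht, hF _ (hγ t (Ioc_subset_Icc_self hm))]
    simp [Bicomplex.kernel, Bicomplex.e, Bicomplex.eDag]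
  have b₁' := (intervalIntegrable_iff_integrableOn_Ioc_of_le zero_le_one).1 b₁
  have b₂' := (intervalIntegrable_iff_integrableOn_Ioc_of_le zero_le_one).1 b₂
  -- The component functions are the integrands of `a₁` and `a₂`, and `rfl` fixes the value of the
  -- area integral.
  refine ⟨?_, _, ⟨_, _, ?_, a₁, a₂, rfl⟩, ?_⟩
  · rw [intervalIntegrable_iff_integrableOn_Ioc_of_le zero_le_one]
    exact (Integrable.prodMk b₁' b₂').congr hI.symm
  · intro Z hZ
    beta_reduce
    rw [weightedCR_eq hΩ₁ hΩ₂ ϑ φ (hf₁.differentiableOn one_ne_zero)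
      (hf₂.differentiableOn one_ne_zero) hF (hS hZ)]
    ext <;> simp [Bicomplex.kernel, Bicomplex.e, Bicomplex.eDag]
  · rw [intervalIntegral.integral_of_le zero_le_one, integral_congr_ae hI,
      integral_pair b₁' b₂', hF W (hS hW)]
    rw [intervalIntegral.integral_of_le zero_le_one] at e₁ e₂
    ext1
    · simp only [Bicomplex.const, Bicomplex.e, Bicomplex.eDag, Prod.fst_mul, Prod.fst_add,
        Prod.fst_sub, Prod.smul_fst, smul_eq_mul, mul_one, mul_zero, add_zero]
      rw [e₁, Bicomplex.Surface.dom₁]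
      -- The factors `I / 2` and `-2 I` multiply to `1`.
      linear_combination (-∫ z in Prod.fst '' S.carrier, _) * Complex.I_mul_I
    · simp only [Bicomplex.const, Bicomplex.e, Bicomplex.eDag, Prod.snd_mul, Prod.snd_add,
        Prod.snd_sub, Prod.smul_snd, smul_eq_mul, mul_one, mul_zero, zero_add]
      rw [e₂, Bicomplex.Surface.dom₂]
      linear_combination (-∫ z in Prod.snd '' S.carrier, _) * Complex.I_mul_I
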